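/- Let $\mathscr{M}$ be the set of isometry classes of non-empty compact metric spaces, equipped with the Gromov–Hausdorff distance $\mathcal{GH}$, and let $\mathbf{Q}=[0,1]^{\mathbb{N}}$ be the Hilbert cube with the product topology. A map $\mathcal{D}:\mathscr{M}\to[0,\infty]$ is called a *dimensional function* if (i) $\mathcal{D}(S,d)\le\mathcal{D}(X,d)$ for every $(X,d)\in\mathscr{M}$ and every non-empty closed subset $S\subset X$ (with the restricted metric), and (ii) for every $\epsilon\in(0,\infty)$ there is a non-empty compact metric space $(Z,h)$ with $\mathcal{D}(Z,h)=\infty$ and diameter at most $\epsilon$. Put $\mathscr{I}(\mathcal{D})=\{(X,d)\in\mathscr{M} : \mathcal{D}(X,d)=\infty\}$. A *geodesic* from $x$ to $y$ in $\mathscr{M}$ is a continuous map $\gamma:[0,1]\to\mathscr{M}$ with $\gamma(0)=x$, $\gamma(1)=y$ and $\mathcal{GH}(\gamma(s),\gamma(t))=|s-t|\cdot\mathcal{GH}(x,y)$ for all $s,t\in[0,1]$. For a closed set $A\subset[0,1]$ with $\{0,1\}\subset A$, an *$A$-branching bunch of geodesics* from $x$ to $y$ is a continuous map $F:[0,1]\times\mathbf{Q}\to\mathscr{M}$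 such that 1. $F(0,q)=x$ and $F(1,q)=y$ for every $q\in\mathbf{Q}$; 2. $F(s,q)=F(s,r)$ for every $s\in A$ and all $q,r\in\mathbf{Q}$; 3. for each $q\in\mathbf{Q}$ the map $s\mapsto F(s,q)$ is a geodesic from $x$ to $y$; 4. $F(s,q)\ne F(t,r)$ for all $(s,q),(t,r)\in([0,1]\setminus A)\times\mathbf{Q}$ with $(s,q)\neq(t,r)$. **Theorem.** Let $\mathcal{D}$ be a dimensional function, let $(X,d),(Y,e)\in\mathscr{I}(\mathcal{D})$ satisfy $\mathcal{GH}((X,d),(Y,e))>0$, and let $A$ be a closed subset of $[0,1]$ with $\{0,1\}\subset A$. Then there exists an $A$-branching bunch of geodesics $F:[0,1]\times\mathbf{Q}\to\mathscr{M}$ from $(X,d)$ to $(Y,e)$ such that $F(s,q)\in\mathscr{I}(\mathcal{D})$ for all $(s,q)\in[0,1]\times\mathbf{Q}$. -/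

import Mathlib

open GromovHausdorff
open scoped unitInterval ENNReal

/-- A geodesic from `x` to `y` in a metric space `M`: a continuous map `γ : [0, 1] → M` with
`γ 0 = x`, `γ 1 = y` and `d (γ s) (γ t) = |s - t| * d x y` for all `s, t`. -/
structure IsGeodesic {M : Type*} [MetricSpace M] (x y : M) (γ : I → M) : Prop where
  continuous : Continuous γ
  source : γ 0 = x
  target : γ 1 = y
  dist_eq : ∀ s t : I, dist (γ s) (γ t) = |(s : ℝ) - (t : ℝ)| * dist x y

/-- The Hilbert cube `[0, 1]^ℕ` with the product topology. -/
abbrev HilbertCube : Type := ℕ → I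

/-- An `A`-branching bunch of geodesics from `x` to `y` in a metric space `M`
(to be used with `M` the Gromov--Hausdorff space and `A` closed, `0, 1 ∈ A`). -/
structure IsBranchingBunch {M : Type*} [MetricSpace M] (A : Set I) (x y : M)
    (F : I × HilbertCube → M) : Prop where
  continuous : Continuous F
  endpoints : ∀ q : HilbertCube, F (0, q) = x ∧ F (1, q) = y
  eq_on : ∀ s ∈ A, ∀ q r : HilbertCube, F (s, q) = F (s, r)
  geodesic : ∀ q : HilbertCube, IsGeodesic x y (fun s => F (s, q))
  ne_off : ∀ (s t : I) (q r : HilbertCube), s ∉ A → t ∉ A → (s, q) ≠ (t, r) →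
    F (s, q) ≠ F (t, r)

/-- A dimensional function: a `[0, ∞]`-valued function on the set `GHSpace` of isometry classes of
nonempty compact metric spaces which is monotone under passing to (nonempty) closed subsets with
the restricted metric, and for which there are compact metric spaces of arbitrarily small diameter
with value `∞`. -/
structure IsDimensionalFunction (D : GHSpace → ℝ≥0∞) : Prop where
  mono : ∀ (X : Type) [MetricSpace X] [CompactSpace X] [Nonempty X] (S : Set X)
    (hS : IsClosed S) (hne : S.Nonempty),
    D (TopologicalSpace.NonemptyCompacts.toGHSpace ⟨⟨S, hS.isCompact⟩, hne⟩) ≤ D (toGHSpace X)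
  small : ∀ ε : ℝ, 0 < ε →
    ∃ (Y : Type) (_ : MetricSpace Y) (_ : CompactSpace Y) (_ : Nonempty Y),
      D (toGHSpace Y) = ⊤ ∧ Metric.diam (Set.univ : Set Y) ≤ ε

/-- The set of all (isometry classes of) compact metric spaces at which `D` is infinite. -/
def infiniteSet (D : GHSpace → ℝ≥0∞) : Set GHSpace := {x | D x = ⊤}

/-! Let `r` be the distance from `x` to `y`, and `R` an optimal correspondence, of distortion at
most `2 * r`. Every `F (s, q)` is the metric quotient of one compact space `(R × Z) ⊕ OnePoint ℕ` by
the maximum of three pseudo-distances: the interpolation of the metrics of `x` and `y` along `R`,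
the metric of `Z` truncated at `2 * r * min s (1 - s)`, and a hedgehog metric on labels scaled by `2
* r` times the distance from `s` to `A`. The last two vanish at the endpoints, the last one on `A`.

All three are `2 * r`-Lipschitz in `s` (`abs_bunchDist_sub_le`), so `s ↦ F (s, q)` is `r`-Lipschitz;
as its endpoints are at distance `r`, it is a geodesic. For `0 < s < 1` the space contains small
pieces of `Z` isometrically, hence a piece where `D` is infinite. Off `A` the labels give the only
isolated points, since `Z` has none, and their isolation radii encode `q`
(`eq_of_bunchDist_realized`); `s` itself is read off from the distance to `x`. -/

/-- Two compact metric spaces covered by a common index set, with distances differing by at most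
`2 * δ`, are at Gromov--Hausdorff distance at most `δ`. -/
theorem ghDist_le_of_surjective {W X Y : Type} [MetricSpace X] [CompactSpace X] [Nonempty X]
    [MetricSpace Y] [CompactSpace Y] [Nonempty Y] {Φ : W → X} {Ψ : W → Y}
    (hΦ : Function.Surjective Φ) (hΨ : Function.Surjective Ψ) {δ : ℝ} (hδ : 0 ≤ δ)
    (H : ∀ p q, |dist (Φ p) (Φ q) - dist (Ψ p) (Ψ q)| ≤ 2 * δ) : ghDist X Y ≤ δ := by
  -- Gluing at distance `δ` itself would fail to be a metric when `δ = 0`, hence the slack `ε`.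
  refine le_of_forall_pos_le_add fun ε hε => ?_
  have hpos : 0 < δ + ε := by linarith
  have hW : Nonempty W := hΦ.nonempty
  let _ : MetricSpace (X ⊕ Y) := Metric.glueMetricApprox Φ Ψ (δ + ε) hpos
    fun p q => (H p q).trans (by linarith)
  have key : ∀ p, dist (Sum.inl (Φ p) : X ⊕ Y) (Sum.inr (Ψ p)) = δ + ε :=
    Metric.glueDist_glued_points Φ Ψ (δ + ε)
  refine (ghDist_le_hausdorffDist (Φ := (Sum.inl : X → X ⊕ Y)) (Ψ := (Sum.inr : Y → X ⊕ Y))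
    (Isometry.of_dist_eq fun _ _ => rfl) (Isometry.of_dist_eq fun _ _ => rfl)).trans ?_
  refine Metric.hausdorffDist_le_of_mem_dist hpos.le ?_ ?_
  · rintro _ ⟨x, rfl⟩
    obtain ⟨p, rfl⟩ := hΦ x
    exact ⟨_, ⟨Ψ p, rfl⟩, (key p).le⟩
  · rintro _ ⟨y, rfl⟩
    obtain ⟨p, rfl⟩ := hΨ y
    exact ⟨_, ⟨Φ p, rfl⟩, by rw [dist_comm]; exact (key p).le⟩

/-! ### Pseudo-distances and their metric quotients -/

/-- A pseudo-distance on `W`. -/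
structure IsPseudoDist {W : Type*} (ρ : W → W → ℝ) : Prop where
  self : ∀ w, ρ w w = 0
  comm : ∀ v w, ρ v w = ρ w v
  triangle : ∀ u v w, ρ u w ≤ ρ u v + ρ v w

namespace IsPseudoDist

variable {W : Type*} {ρ τ : W → W → ℝ}

theorem nonneg (h : IsPseudoDist ρ) (v w : W) : 0 ≤ ρ v w := by
  have := h.triangle v w v
  rw [h.self, h.comm w v] at this
  linarith

theorem dist_comp {X : Type*} [PseudoMetricSpace X] (f : W → X) :
    IsPseudoDist fun v w => dist (f v) (f w) :=
  ⟨fun _ => dist_self _, fun _ _ => dist_comm _ _, fun _ _ _ => dist_triangle _ _ _⟩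

theorem comp (h : IsPseudoDist ρ) {V : Type*} (f : V → W) :
    IsPseudoDist fun v w => ρ (f v) (f w) :=
  ⟨fun _ => h.self _, fun _ _ => h.comm _ _, fun _ _ _ => h.triangle _ _ _⟩

theorem add (h : IsPseudoDist ρ) (k : IsPseudoDist τ) :
    IsPseudoDist fun v w => ρ v w + τ v w :=
  ⟨fun w => by simp [h.self, k.self], fun v w => by rw [h.comm, k.comm],
    fun u v w => by linarith [h.triangle u v w, k.triangle u v w]⟩

theorem const_mul (h : IsPseudoDist ρ) {c : ℝ} (hc : 0 ≤ c) : IsPseudoDist fun v w => c * ρ v w :=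
  ⟨fun w => by simp [h.self], fun v w => by rw [h.comm],
    fun u v w => by nlinarith [h.triangle u v w]⟩

theorem max (h : IsPseudoDist ρ) (k : IsPseudoDist τ) :
    IsPseudoDist fun v w => max (ρ v w) (τ v w) :=
  ⟨fun w => by simp [h.self, k.self], fun v w => by rw [h.comm, k.comm],
    fun u v w => max_le
      ((h.triangle u v w).trans (add_le_add (le_max_left _ _) (le_max_left _ _)))
      ((k.triangle u v w).trans (add_le_add (le_max_right _ _) (le_max_right _ _)))⟩

theorem min_const (h : IsPseudoDist ρ) {c : ℝ} (hc : 0 ≤ c) :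
    IsPseudoDist fun v w => min (ρ v w) c := by
  refine ⟨fun w => by simp [h.self, hc], fun v w => by rw [h.comm], fun u v w => ?_⟩
  have h1 := h.nonneg u v
  have h2 := h.nonneg v w
  have h3 := h.triangle u v w
  rcases le_total (ρ u v) c with h4 | h4 <;> rcases le_total (ρ v w) c with h5 | h5 <;>
    simp only [min_eq_left h4, min_eq_right h4, min_eq_left h5, min_eq_right h5]
  · exact (min_le_left _ _).trans h3
  all_goals exact (min_le_right _ _).trans (by linarith)

theorem exists_metric_quotient {W : Type} {ρ : W → W → ℝ} (h : IsPseudoDist ρ) :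
    ∃ (V : Type) (π : W → V) (_ : MetricSpace V), Function.Surjective π ∧
      ∀ v w, dist (π v) (π w) = ρ v w := by
  let _ : PseudoMetricSpace W :=
    { dist := ρ
      dist_self := h.self
      dist_comm := h.comm
      dist_triangle := h.triangle }
  exact ⟨SeparationQuotient W, SeparationQuotient.mk, inferInstance,
    SeparationQuotient.surjective_mk, fun _ _ => rfl⟩

/-- The metric quotient of a compact space by a continuous pseudo-distance, as a point of the
Gromov--Hausdorff space. -/
theorem exists_ghSpace {W : Type} [TopologicalSpace W] [CompactSpace W] [Nonempty W]
    {ρ : W → W → ℝ} (h : IsPseudoDist ρ) (hc : Continuous fun p : W × W => ρ p.1 p.2) :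
    ∃ (g : GHSpace) (Φ : W → g.Rep), Function.Surjective Φ ∧
      ∀ v w, dist (Φ v) (Φ w) = ρ v w := by
  obtain ⟨V, π, hV, hπ, hdist⟩ := h.exists_metric_quotient
  have hcont : Continuous π := by
    rw [Metric.continuous_iff']
    intro w ε hε
    have h1 : Continuous fun v => ρ v w := hc.comp (continuous_id.prodMk continuous_const)
    have h2 := h1.tendsto w
    rw [h.self] at h2
    filter_upwards [h2.eventually_lt_const hε] with v hv
    rwa [hdist]
  have : CompactSpace V := hπ.compactSpace hcont
  have : Nonempty V := ‹Nonempty W›.map π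
  obtain ⟨e⟩ := toGHSpace_eq_toGHSpace_iff_isometryEquiv.1 (toGHSpace V).toGHSpace_rep.symm
  exact ⟨toGHSpace V, e ∘ π, e.surjective.comp hπ, fun v w => by
    rw [← hdist]; exact e.dist_eq _ _⟩

end IsPseudoDist

/-! ### Optimal correspondences -/

/-- A correspondence of least possible distortion between two compact metric spaces. -/
theorem exists_optimal_correspondence (X Y : Type) [MetricSpace X] [CompactSpace X] [Nonempty X]
    [MetricSpace Y] [CompactSpace Y] [Nonempty Y] :
    ∃ R : Set (X × Y), IsClosed R ∧ (∀ x, ∃ y, (x, y) ∈ R) ∧ (∀ y, ∃ x, (x, y) ∈ R) ∧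
      ∀ p ∈ R, ∀ q ∈ R, |dist p.1 q.1 - dist p.2 q.2| ≤ 2 * ghDist X Y := by
  have hl := isometry_optimalGHInjl X Y
  have hr := isometry_optimalGHInjr X Y
  have hcl := isCompact_range hl.continuous
  have hcr := isCompact_range hr.continuous
  have hfin : Metric.hausdorffEDist (Set.range (optimalGHInjl X Y))
      (Set.range (optimalGHInjr X Y)) ≠ ⊤ :=
    Metric.hausdorffEDist_ne_top_of_nonempty_of_bounded (Set.range_nonempty _)
      (Set.range_nonempty _) hcl.isBounded hcr.isBounded
  -- Pairs within the Hausdorff distance in an optimal coupling; compactness supplies nearest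
  -- points, so both projections are onto.
  refine ⟨{p | dist (optimalGHInjl X Y p.1) (optimalGHInjr X Y p.2) ≤ ghDist X Y},
    isClosed_le ((hl.continuous.comp continuous_fst).dist (hr.continuous.comp continuous_snd))
      continuous_const, fun x => ?_, fun y => ?_, ?_⟩
  · obtain ⟨_, ⟨y, rfl⟩, hy⟩ := hcr.exists_infDist_eq_dist (Set.range_nonempty _)
      (optimalGHInjl X Y x)
    refine ⟨y, ?_⟩
    rw [Set.mem_ofPred_eq, ← hausdorffDist_optimal, ← hy]
    exact Metric.infDist_le_hausdorffDist_of_mem ⟨x, rfl⟩ hfin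
  · obtain ⟨_, ⟨x, rfl⟩, hx⟩ := hcl.exists_infDist_eq_dist (Set.range_nonempty _)
      (optimalGHInjr X Y y)
    refine ⟨x, ?_⟩
    rw [Set.mem_ofPred_eq, ← hausdorffDist_optimal, dist_comm, ← hx, Metric.hausdorffDist_comm]
    exact Metric.infDist_le_hausdorffDist_of_mem ⟨y, rfl⟩ (by rwa [Metric.hausdorffEDist_comm])
  · rintro ⟨x, y⟩ hp ⟨x', y'⟩ hq
    rw [Set.mem_ofPred_eq] at hp hq
    simp only at hp hq ⊢
    rw [← hl.dist_eq x x', ← hr.dist_eq y y']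
    have h1 := dist_triangle4 (optimalGHInjl X Y x) (optimalGHInjr X Y y) (optimalGHInjr X Y y')
      (optimalGHInjl X Y x')
    have h2 := dist_triangle4 (optimalGHInjr X Y y) (optimalGHInjl X Y x) (optimalGHInjl X Y x')
      (optimalGHInjr X Y y')
    rw [dist_comm (optimalGHInjr X Y y') (optimalGHInjl X Y x')] at h1
    rw [dist_comm (optimalGHInjr X Y y) (optimalGHInjl X Y x)] at h2
    rw [abs_le]
    constructor <;> linarith

/-! ### Small pieces of infinite dimension -/

namespace IsDimensionalFunction

variable {D : GHSpace → ℝ≥0∞}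

theorem le_of_isometry (hD : IsDimensionalFunction D) {V : Type} [MetricSpace V] [CompactSpace V]
    [Nonempty V] {g : GHSpace} {f : V → g.Rep} (hf : Isometry f) : D (toGHSpace V) ≤ D g := by
  have h := hD.mono g.Rep (Set.range f) (isCompact_range hf.continuous).isClosed
    (Set.range_nonempty f)
  rw [g.toGHSpace_rep] at h
  refine le_of_eq_of_le (congrArg D ?_) h
  exact toGHSpace_eq_toGHSpace_iff_isometryEquiv.2 ⟨hf.isometryEquivOnRange⟩

/-- There is a compact metric space without isolated points which contains arbitrarily small
spaces of infinite dimension. -/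
theorem exists_universal (hD : IsDimensionalFunction D) :
    ∃ (Z : Type) (_ : MetricSpace Z) (_ : CompactSpace Z) (_ : Nonempty Z),
      (∀ (z : Z) (ε : ℝ), 0 < ε → ∃ z', z' ≠ z ∧ dist z' z < ε) ∧
      ∀ ε : ℝ, 0 < ε → ∃ (V : Type) (_ : MetricSpace V) (_ : CompactSpace V) (_ : Nonempty V)
        (f : V → Z), D (toGHSpace V) = ⊤ ∧ Isometry f ∧ ∀ v w : V, dist v w ≤ ε := by
  -- The product metric sums `min (2⁻¹ ^ n) (dist ..)`, so this diameter bound embeds each factor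
  -- isometrically.
  choose V hm hc hne hV hdiam using fun n : ℕ => hD.small (2⁻¹ ^ n) (by positivity)
  have hle : ∀ n (v w : V n), dist v w ≤ 2⁻¹ ^ n := fun n v w =>
    (Metric.dist_le_diam_of_mem isCompact_univ.isBounded trivial trivial).trans (hdiam n)
  let _ : MetricSpace (∀ n, V n) := PiCountable.metricSpace
  -- The factor `I` removes isolated points.
  refine ⟨(∀ n, V n) × I, inferInstance, inferInstance, inferInstance, ?_, ?_⟩
  · rintro ⟨z, u⟩ ε hε
    obtain ⟨u', h1, h2⟩ : ∃ u' : I, u' ≠ u ∧ dist u' u < ε := by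
      have := (mem_closure_iff_nhdsWithin_neBot.2 (inferInstance : (nhdsWithin u {u}ᶜ).NeBot))
      obtain ⟨u', h1, h2⟩ := Metric.mem_closure_iff.1 this ε hε
      exact ⟨u', h1, by rwa [dist_comm]⟩
    refine ⟨(z, u'), fun h => h1 (congrArg Prod.snd h), ?_⟩
    rw [Prod.dist_eq]
    exact max_lt (by simpa using hε) h2
  · intro ε hε
    obtain ⟨n, hn⟩ := exists_pow_lt_of_lt_one hε (show (2⁻¹ : ℝ) < 1 by norm_num)
    let z₀ : ∀ n, V n := fun n => Classical.arbitrary _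
    refine ⟨V n, hm n, hc n, hne n, fun v => (Function.update z₀ n v, 0), hV n,
      Isometry.of_dist_eq fun v w => ?_, fun v w => (hle n v w).trans hn.le⟩
    have h1 : dist (Function.update z₀ n v) (Function.update z₀ n w) = dist v w := by
      refine (tsum_eq_single n fun m hm => ?_).trans ?_
      · simp [Function.update_of_ne hm]
      · simpa using hle n v w
    rw [Prod.dist_eq, h1]
    simp

end IsDimensionalFunction

/-! ### Encoding the Hilbert cube by isolation radii -/

/-- The distance from the limit point to the `n`-th point of the sequence space encoding a point
`q` of the Hilbert cube. The ranges for different `n` are disjoint. -/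
noncomputable def labelRadius (q : HilbertCube) (n : ℕ) : ℝ := 4⁻¹ ^ (n + 1) * (1 + (q n : ℝ))

theorem labelRadius_pos (q : HilbertCube) (n : ℕ) : 0 < labelRadius q n := by
  have := (q n).2.1
  unfold labelRadius
  positivity

theorem labelRadius_le (q : HilbertCube) (n : ℕ) : labelRadius q n ≤ 2⁻¹ * 4⁻¹ ^ n := by
  have h1 := (q n).2.2
  have h2 : (0 : ℝ) < 4⁻¹ ^ n := by positivity
  rw [labelRadius, pow_succ]
  nlinarith

theorem labelRadius_lt_of_lt (q q' : HilbertCube) {m n : ℕ} (h : m < n) :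
    labelRadius q n < labelRadius q' m := by
  have h1 := labelRadius_le q n
  have h2 : (4⁻¹ : ℝ) ^ n ≤ 4⁻¹ ^ (m + 1) :=
    pow_le_pow_of_le_one (by norm_num) (by norm_num) h
  have h3 := (q' m).2.1
  have h4 : (0 : ℝ) < 4⁻¹ ^ (m + 1) := by positivity
  have h5 : (4⁻¹ : ℝ) ^ (m + 1) ≤ labelRadius q' m := by
    unfold labelRadius
    nlinarith
  linarith

theorem eq_of_labelRadius_eq {q q' : HilbertCube} {m n : ℕ}
    (h : labelRadius q n = labelRadius q' m) : n = m ∧ q n = q' m := by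
  rcases lt_trichotomy n m with h1 | rfl | h1
  · exact absurd h (labelRadius_lt_of_lt q' q h1).ne'
  · refine ⟨rfl, Subtype.ext ?_⟩
    have h4 : (4⁻¹ : ℝ) ^ (n + 1) ≠ 0 := by positivity
    simpa [labelRadius] using h
  · exact absurd h (labelRadius_lt_of_lt q q' h1).ne

/-- The indicator of the `n`-th point of the one-point compactification of `ℕ`. -/
noncomputable def labelIndicator (n : ℕ) : OnePoint ℕ → ℝ := Set.indicator {(n : OnePoint ℕ)} 1

theorem continuous_labelIndicator (n : ℕ) : Continuous (labelIndicator n) := by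
  refine continuous_one.indicator fun a ha => absurd ha ?_
  have : IsClopen ({(n : OnePoint ℕ)} : Set (OnePoint ℕ)) := by
    refine ⟨isClosed_singleton, ?_⟩
    have := OnePoint.isOpenEmbedding_coe.isOpenMap {n} (isOpen_discrete _)
    simpa using this
  simp [this.frontier_eq]

theorem labelIndicator_self (n : ℕ) : labelIndicator n n = 1 := by simp [labelIndicator]

theorem labelIndicator_of_ne {n : ℕ} {a : OnePoint ℕ} (h : a ≠ n) : labelIndicator n a = 0 := by
  simp [labelIndicator, h]

theorem abs_labelIndicator_sub_le (n : ℕ) (a b : OnePoint ℕ) :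
    |labelIndicator n a - labelIndicator n b| ≤ 1 := by
  by_cases ha : a = n <;> by_cases hb : b = n <;>
    simp [ha, hb, labelIndicator]

/-- The hedgehog distance on the one-point compactification of `ℕ`, with the `n`-th point at
distance `labelRadius q n` from `∞`. -/
noncomputable def labelDist (q : HilbertCube) (a b : OnePoint ℕ) : ℝ :=
  ∑' n, labelRadius q n * |labelIndicator n a - labelIndicator n b|

theorem labelDist_term_le (q : HilbertCube) (a b : OnePoint ℕ) (n : ℕ) :
    labelRadius q n * |labelIndicator n a - labelIndicator n b| ≤ 2⁻¹ * 4⁻¹ ^ n :=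
  (mul_le_of_le_one_right (labelRadius_pos q n).le (abs_labelIndicator_sub_le n a b)).trans
    (labelRadius_le q n)

theorem labelDist_term_nonneg (q : HilbertCube) (a b : OnePoint ℕ) (n : ℕ) :
    0 ≤ labelRadius q n * |labelIndicator n a - labelIndicator n b| :=
  mul_nonneg (labelRadius_pos q n).le (abs_nonneg _)

theorem hasSum_label_bound : HasSum (fun n : ℕ => (2⁻¹ : ℝ) * 4⁻¹ ^ n) (2 / 3) := by
  have := (hasSum_geometric_of_lt_one (r := (4⁻¹ : ℝ)) (by norm_num) (by norm_num)).mul_left 2⁻¹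
  norm_num at this ⊢
  exact this

theorem summable_labelDist (q : HilbertCube) (a b : OnePoint ℕ) :
    Summable fun n => labelRadius q n * |labelIndicator n a - labelIndicator n b| :=
  .of_nonneg_of_le (labelDist_term_nonneg q a b) (labelDist_term_le q a b)
    hasSum_label_bound.summable

theorem labelDist_le_one (q : HilbertCube) (a b : OnePoint ℕ) : labelDist q a b ≤ 1 := by
  have := (summable_labelDist q a b).tsum_le_tsum (labelDist_term_le q a b)
    hasSum_label_bound.summable
  rw [hasSum_label_bound.tsum_eq] at this
  exact this.trans (by norm_num)

theorem isPseudoDist_labelDist (q : HilbertCube) : IsPseudoDist (labelDist q) where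
  self a := by simp [labelDist]
  comm a b := by simp only [labelDist, abs_sub_comm]
  triangle a b c := by
    unfold labelDist
    rw [← (summable_labelDist q a b).tsum_add (summable_labelDist q b c)]
    refine (summable_labelDist q a c).tsum_le_tsum (fun n => ?_)
      ((summable_labelDist q a b).add (summable_labelDist q b c))
    rw [← mul_add]
    exact mul_le_mul_of_nonneg_left (abs_sub_le _ _ _) (labelRadius_pos q n).le

theorem continuous_labelDist :
    Continuous fun p : HilbertCube × OnePoint ℕ × OnePoint ℕ => labelDist p.1 p.2.1 p.2.2 := by
  refine continuous_tsum (fun n => ?_) hasSum_label_bound.summable fun n p => ?_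
  · have := continuous_labelIndicator n
    unfold labelRadius
    fun_prop
  · rw [Real.norm_of_nonneg (labelDist_term_nonneg _ _ _ n)]
    exact labelDist_term_le _ _ _ n

theorem labelRadius_le_labelDist (q : HilbertCube) {n : ℕ} {a : OnePoint ℕ} (h : a ≠ n) :
    labelRadius q n ≤ labelDist q n a := by
  have := (summable_labelDist q n a).le_tsum n fun m _ => labelDist_term_nonneg q n a m
  simpa [labelDist, labelIndicator_self, labelIndicator_of_ne h] using this

theorem labelDist_infty (q : HilbertCube) (n : ℕ) :
    labelDist q n OnePoint.infty = labelRadius q n := by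
  refine (tsum_eq_single n fun m hm => ?_).trans ?_
  · rw [labelIndicator_of_ne (OnePoint.infty_ne_coe m), labelIndicator_of_ne, sub_self, abs_zero,
      mul_zero]
    simpa using hm.symm
  · simp [labelIndicator_self, labelIndicator_of_ne]

/-! ### The pseudo-distances defining the bunch -/

section BunchSpace

variable {X Y Z : Type} [MetricSpace X] [MetricSpace Y] [MetricSpace Z] {R : Set (X × Y)}

/-- The common parameter space of the bunch: a correspondence times an auxiliary space, together
with a sequence of labels. -/
abbrev BunchSpace (R : Set (X × Y)) (Z : Type) : Type := (R × Z) ⊕ OnePoint ℕ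

/-- The position of a point, where all labels sit at the base point `b`. -/
def BunchSpace.pos (b : R × Z) : BunchSpace R Z → R × Z := Sum.elim id fun _ => b

/-- The label of a point, which is `∞` away from the sequence of labels. -/
def BunchSpace.label : BunchSpace R Z → OnePoint ℕ := Sum.elim (fun _ => OnePoint.infty) id

open BunchSpace

theorem BunchSpace.continuous_pos (b : R × Z) : Continuous (pos b) :=
  continuous_id.sumElim continuous_const

theorem BunchSpace.continuous_label : Continuous (label : BunchSpace R Z → OnePoint ℕ) :=
  continuous_const.sumElim continuous_id

/-- The family of pseudo-distances defining the bunch of geodesics. -/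
noncomputable def bunchDist (b : R × Z) (A : Set I) (r : ℝ) (p : I × HilbertCube)
    (v w : BunchSpace R Z) : ℝ :=
  max
    (max ((1 - p.1) * dist (pos b v).1.1.1 (pos b w).1.1.1 +
        p.1 * dist (pos b v).1.1.2 (pos b w).1.1.2)
      (min (dist (pos b v).2 (pos b w).2) (2 * r * min (p.1 : ℝ) (1 - p.1))))
    (2 * r * Metric.infDist p.1 A * labelDist p.2 (label v) (label w))

variable (b : R × Z) (A : Set I) {r : ℝ}

theorem isPseudoDist_bunchDist (hr : 0 ≤ r) (p : I × HilbertCube) :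
    IsPseudoDist (bunchDist b A r p) := by
  have h0 := p.1.2.1
  have h1 : 0 ≤ 1 - (p.1 : ℝ) := sub_nonneg.2 p.1.2.2
  refine ((((IsPseudoDist.dist_comp fun v => (pos b v).1.1.1).const_mul h1).add
    ((IsPseudoDist.dist_comp fun v => (pos b v).1.1.2).const_mul h0)).max
    ((IsPseudoDist.dist_comp fun v => (pos b v).2).min_const ?_)).max
    (((isPseudoDist_labelDist p.2).comp label).const_mul ?_)
  · have := le_min h0 h1
    positivity
  · have := Metric.infDist_nonneg (x := p.1) (s := A)
    positivity

theorem continuous_bunchDist : Continuous fun x : (I × HilbertCube) ×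
    (BunchSpace R Z × BunchSpace R Z) => bunchDist b A r x.1 x.2.1 x.2.2 := by
  have h1 := BunchSpace.continuous_pos b
  have h2 := BunchSpace.continuous_label (R := R) (Z := Z)
  have h3 := Metric.continuous_infDist_pt A
  have h4 : Continuous fun x : (I × HilbertCube) × (BunchSpace R Z × BunchSpace R Z) =>
      labelDist x.1.2 (label x.2.1) (label x.2.2) :=
    continuous_labelDist.comp (by fun_prop : Continuous fun x : (I × HilbertCube) ×
      (BunchSpace R Z × BunchSpace R Z) => (x.1.2, label x.2.1, label x.2.2))
  unfold bunchDist
  fun_prop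

/-- Maxima and minima preserve Lipschitz bounds. The interpolation has slope at most the distortion;
`min s (1 - s)` and the distance to `A` are 1-Lipschitz, and `labelDist` is at most 1. -/
theorem abs_bunchDist_sub_le (hr : 0 ≤ r)
    (hR : ∀ p ∈ R, ∀ q ∈ R, |dist p.1 q.1 - dist p.2 q.2| ≤ 2 * r) (s t : I) (q : HilbertCube)
    (v w : BunchSpace R Z) :
    |bunchDist b A r (s, q) v w - bunchDist b A r (t, q) v w| ≤
      2 * (|(s : ℝ) - t| * r) := by
  have hst := abs_nonneg ((s : ℝ) - t)
  refine (abs_max_sub_max_le_max _ _ _ _).trans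
    (max_le ((abs_max_sub_max_le_max _ _ _ _).trans (max_le ?_ ?_)) ?_)
  · have h := hR _ (pos b v).1.2 _ (pos b w).1.2
    calc _ = |((t : ℝ) - s) * (dist (pos b v).1.1.1 (pos b w).1.1.1 -
              dist (pos b v).1.1.2 (pos b w).1.1.2)| := by congr 1; ring
      _ ≤ |(s : ℝ) - t| * (2 * r) := by
        rw [abs_mul, abs_sub_comm]; exact mul_le_mul_of_nonneg_left h hst
      _ = _ := by ring
  · refine (abs_min_sub_min_le_max _ _ _ _).trans (max_le (by simpa using by positivity) ?_)
    rw [← mul_sub, abs_mul, abs_of_nonneg (by positivity : 0 ≤ 2 * r)]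
    have : |min (s : ℝ) (1 - s) - min (t : ℝ) (1 - t)| ≤ |(s : ℝ) - t| := by
      refine (abs_min_sub_min_le_max _ _ _ _).trans (max_le le_rfl ?_)
      rw [sub_sub_sub_cancel_left, abs_sub_comm]
    calc _ ≤ 2 * r * |(s : ℝ) - t| := by gcongr
      _ = _ := by ring
  · have h1 : |Metric.infDist s A - Metric.infDist t A| ≤ |(s : ℝ) - t| :=
      (Metric.lipschitz_infDist_pt A).dist_le_mul s t |>.trans
        (by simp [Subtype.dist_eq, Real.dist_eq])
    have h2 := (isPseudoDist_labelDist q).nonneg (label v) (label w)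
    have h3 := labelDist_le_one q (label v) (label w)
    dsimp only
    rw [← sub_mul, ← mul_sub, abs_mul, abs_mul, abs_of_nonneg h2,
      abs_of_nonneg (by positivity : 0 ≤ 2 * r)]
    calc _ ≤ 2 * r * |(s : ℝ) - t| * 1 := by gcongr
      _ = _ := by ring

variable {A} in
theorem bunchDist_of_mem {s : I} (hs : s ∈ A) (q q' : HilbertCube) :
    bunchDist b A r (s, q) = bunchDist b A r (s, q') := by
  ext v w
  simp [bunchDist, Metric.infDist_zero_of_mem hs]

variable {A} in
theorem bunchDist_zero (h0 : 0 ∈ A) (q : HilbertCube) (v w : BunchSpace R Z) :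
    bunchDist b A r (0, q) v w = dist (pos b v).1.1.1 (pos b w).1.1.1 := by
  simp [bunchDist, Metric.infDist_zero_of_mem h0]

variable {A} in
theorem bunchDist_one (h1 : 1 ∈ A) (q : HilbertCube) (v w : BunchSpace R Z) :
    bunchDist b A r (1, q) v w = dist (pos b v).1.1.2 (pos b w).1.1.2 := by
  simp [bunchDist, Metric.infDist_zero_of_mem h1]

variable {A} in
theorem bunchDist_inl (p : I × HilbertCube) (k : R) (z z' : Z)
    (hz : dist z z' ≤ 2 * r * min (p.1 : ℝ) (1 - p.1)) :
    bunchDist b A r p (Sum.inl (k, z)) (Sum.inl (k, z')) = dist z z' := by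
  simp [bunchDist, pos, label, (isPseudoDist_labelDist p.2).self, min_eq_left hz]

theorem bunchDist_label_infty (hr : 0 ≤ r) (p : I × HilbertCube) (n : ℕ) :
    bunchDist b A r p (Sum.inr n) (Sum.inl b) =
      2 * r * Metric.infDist p.1 A * labelRadius p.2 n := by
  have h0 := p.1.2.1
  have h1 : 0 ≤ 1 - (p.1 : ℝ) := sub_nonneg.2 p.1.2.2
  have h2 := le_min h0 h1
  have h3 := Metric.infDist_nonneg (x := p.1) (s := A)
  have h4 := (labelRadius_pos p.2 n).le
  have h5 : 0 ≤ 2 * r * min (p.1 : ℝ) (1 - p.1) := by positivity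
  have h6 : 0 ≤ 2 * r * Metric.infDist p.1 A * labelRadius p.2 n := by positivity
  simp only [bunchDist, pos, label, Sum.elim_inr, Sum.elim_inl, id, dist_self, labelDist_infty,
    mul_zero, add_zero, min_eq_left h5, max_self, max_eq_right h6]

theorem le_bunchDist_label (hr : 0 ≤ r) (p : I × HilbertCube) (n : ℕ) {w : BunchSpace R Z}
    (hw : w ≠ Sum.inr (n : OnePoint ℕ)) :
    2 * r * Metric.infDist p.1 A * labelRadius p.2 n ≤ bunchDist b A r p (Sum.inr n) w := by
  refine le_trans (mul_le_mul_of_nonneg_left (labelRadius_le_labelDist p.2 (a := label w) ?_) ?_)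
    (le_max_right _ _)
  · rcases w with w | a
    · exact OnePoint.infty_ne_coe n
    · exact fun h => hw (congrArg Sum.inr h)
  · have := Metric.infDist_nonneg (x := p.1) (s := A)
    positivity

/-- The radii of isolated points recover the parameter of the bunch. -/
theorem eq_of_bunchDist_realized (hr : 0 < r) {s : I} (hs0 : 0 < (s : ℝ)) (hs1 : (s : ℝ) < 1)
    (hsA : 0 < Metric.infDist s A) (hZ : ∀ (z : Z) (ε : ℝ), 0 < ε → ∃ z', z' ≠ z ∧ dist z' z < ε)
    {q q' : HilbertCube} {V : Type*} [MetricSpace V] {Φ Ψ : BunchSpace R Z → V}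
    (hΦ : Function.Surjective Φ) (hΨ : Function.Surjective Ψ)
    (hΦd : ∀ v w, dist (Φ v) (Φ w) = bunchDist b A r (s, q) v w)
    (hΨd : ∀ v w, dist (Ψ v) (Ψ w) = bunchDist b A r (s, q') v w) : q = q' := by
  have hpos : ∀ (q : HilbertCube) (n : ℕ), 0 < 2 * r * Metric.infDist s A * labelRadius q n :=
    fun q n => by have := labelRadius_pos q n; positivity
  have hc : 0 < 2 * r * min (s : ℝ) (1 - s) := by
    have := lt_min hs0 (sub_pos.2 hs1)
    positivity
  funext n
  have hlow : ∀ p, p ≠ Φ (Sum.inr n) →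
      2 * r * Metric.infDist s A * labelRadius q n ≤ dist (Φ (Sum.inr n)) p := by
    intro p hp
    obtain ⟨w, rfl⟩ := hΦ p
    rw [hΦd]
    exact le_bunchDist_label b A hr.le (s, q) n fun h => hp (congrArg Φ h)
  have hatt : dist (Φ (Sum.inr n)) (Φ (Sum.inl b)) =
      2 * r * Metric.infDist s A * labelRadius q n := by
    rw [hΦd]
    exact bunchDist_label_infty b A hr.le (s, q) n
  have hne : Φ (Sum.inl b) ≠ Φ (Sum.inr n) := fun h => by
    rw [h, dist_self] at hatt
    exact (hpos q n).ne hatt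
  obtain ⟨w, hw⟩ := hΨ (Φ (Sum.inr n))
  rw [← hw] at hlow hatt hne
  -- In the second description the isolated point is either a label or comes from `R × Z`; the label
  -- `∞` is identified with `b`.
  obtain ⟨m, rfl⟩ | ⟨k, z, hkz⟩ : (∃ m : ℕ, w = Sum.inr (m : OnePoint ℕ)) ∨
      ∃ k z, Ψ w = Ψ (Sum.inl (k, z)) := by
    rcases w with ⟨k, z⟩ | a
    · exact Or.inr ⟨k, z, rfl⟩
    · induction a using OnePoint.rec with
      | infty =>
        refine Or.inr ⟨b.1, b.2, eq_of_dist_eq_zero ?_⟩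
        rw [hΨd]
        have h2 := le_min hs0.le (sub_nonneg.2 hs1.le)
        simp [bunchDist, pos, label, (isPseudoDist_labelDist q').self, hc.le]
      | coe m => exact Or.inl ⟨m, rfl⟩
  -- Both descriptions attain the isolation radius of this point, so the radii agree.
  · obtain ⟨u, hu⟩ := hΨ (Φ (Sum.inl b))
    rw [← hu] at hatt hne
    have h1 : 2 * r * Metric.infDist s A * labelRadius q' m ≤
        2 * r * Metric.infDist s A * labelRadius q n := by
      rw [← hatt, hΨd]
      exact le_bunchDist_label b A hr.le (s, q') m fun h => hne (congrArg Ψ h)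
    have h2 : dist (Ψ (Sum.inr m)) (Ψ (Sum.inl b)) =
        2 * r * Metric.infDist s A * labelRadius q' m := by
      rw [hΨd]
      exact bunchDist_label_infty b A hr.le (s, q') m
    have h3 := hlow (Ψ (Sum.inl b)) fun h => by
      rw [h, dist_self] at h2
      exact (hpos q' m).ne h2
    have h4 : 2 * r * Metric.infDist s A ≠ 0 := by positivity
    obtain ⟨rfl, h⟩ := eq_of_labelRadius_eq (mul_left_cancel₀ h4 ((h3.trans_eq h2).antisymm h1))
    exact h
  -- Points of `R × Z` are not isolated: moving slightly in `Z` stays below the truncation.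
  · exfalso
    obtain ⟨z', hz, hzd⟩ := hZ z _ (lt_min hc (hpos q n))
    have h1 : dist (Ψ (Sum.inl (k, z))) (Ψ (Sum.inl (k, z'))) = dist z z' := by
      rw [hΨd]
      refine bunchDist_inl b (s, q') k z z' ?_
      rw [dist_comm]
      exact (hzd.trans_le (min_le_left _ _)).le
    rw [hkz] at hlow
    have h2 := hlow (Ψ (Sum.inl (k, z'))) fun h => by
      rw [h, dist_self] at h1
      exact hz (dist_eq_zero.1 h1.symm).symm
    rw [h1, dist_comm] at h2
    exact absurd (hzd.trans_le (min_le_right _ _)) h2.not_gt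

end BunchSpace

/-! ### Assembling the bunch -/

theorem mainTheorem4 (D : GHSpace → ℝ≥0∞) (hD : IsDimensionalFunction D)
    (x y : GHSpace) (hx : x ∈ infiniteSet D) (hy : y ∈ infiniteSet D) (hxy : 0 < dist x y)
    (A : Set I) (hA : IsClosed A) (h0 : (0 : I) ∈ A) (h1 : (1 : I) ∈ A) :
    ∃ F : I × HilbertCube → GHSpace,
      IsBranchingBunch A x y F ∧ ∀ p : I × HilbertCube, F p ∈ infiniteSet D := by
  obtain ⟨Z, _, _, _, hperf, hsmall⟩ := hD.exists_universal
  obtain ⟨R, hRc, hRX, hRY, hR⟩ := exists_optimal_correspondence x.Rep y.Rep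
  rw [← dist_ghDist] at hR
  have : CompactSpace R := isCompact_iff_compactSpace.1 hRc.isCompact
  have : Nonempty R := by
    obtain ⟨v, hv⟩ := hRX (Classical.arbitrary _)
    exact ⟨⟨_, hv⟩⟩
  let b : R × Z := Classical.arbitrary _
  have hcont := continuous_bunchDist b A (r := dist x y)
  choose F Φ hΦ hΦd using fun p : I × HilbertCube =>
    (isPseudoDist_bunchDist b A hxy.le p).exists_ghSpace
      (hcont.comp (Continuous.prodMk continuous_const continuous_id))
  have hclose : ∀ p p' (δ : ℝ), 0 ≤ δ →
      (∀ v w, |bunchDist b A (dist x y) p v w - bunchDist b A (dist x y) p' v w| ≤ 2 * δ) →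
      dist (F p) (F p') ≤ δ := by
    intro p p' δ hδ h
    rw [dist_ghDist]
    refine ghDist_le_of_surjective (hΦ p) (hΦ p') hδ fun v w => ?_
    rw [hΦd, hΦd]
    exact h v w
  have hF : Continuous F := by
    -- Currying over a compact space turns joint continuity into continuity for the sup norm, which
    -- controls the distance of the quotients.
    let f : C(I × HilbertCube, C(BunchSpace R Z × BunchSpace R Z, ℝ)) :=
      ContinuousMap.curry ⟨_, hcont⟩
    rw [Metric.continuous_iff']
    intro p ε hε
    filter_upwards [(Metric.continuous_iff'.1 f.continuous) p ε hε] with p' hp'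
    refine (hclose p' p (ε / 2) (by positivity) fun v w => ?_).trans_lt (half_lt_self hε)
    have := ContinuousMap.dist_apply_le_dist (f := f p') (g := f p) (v, w)
    rw [mul_div_cancel₀ _ two_ne_zero]
    exact this.trans hp'.le
  have hF0 : ∀ q, F (0, q) = x := by
    intro q
    refine dist_le_zero.1 ?_
    rw [dist_ghDist]
    refine ghDist_le_of_surjective (hΦ (0, q)) (Ψ := fun v => (BunchSpace.pos b v).1.1.1)
      (fun u => ?_) le_rfl fun v w => ?_
    · obtain ⟨v, hv⟩ := hRX u
      exact ⟨Sum.inl (⟨_, hv⟩, b.2), rfl⟩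
    · rw [hΦd, bunchDist_zero b h0]
      simp
  have hF1 : ∀ q, F (1, q) = y := by
    intro q
    refine dist_le_zero.1 ?_
    rw [dist_ghDist]
    refine ghDist_le_of_surjective (hΦ (1, q)) (Ψ := fun v => (BunchSpace.pos b v).1.1.2)
      (fun u => ?_) le_rfl fun v w => ?_
    · obtain ⟨v, hv⟩ := hRY u
      exact ⟨Sum.inl (⟨_, hv⟩, b.2), rfl⟩
    · rw [hΦd, bunchDist_one b h1]
      simp
  have hlip : ∀ (s t : I) q, dist (F (s, q)) (F (t, q)) ≤ |(s : ℝ) - t| * dist x y :=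
    fun s t q => hclose _ _ _ (by positivity) (abs_bunchDist_sub_le b A hxy.le hR s t q)
  have hdist : ∀ (s t : I) q, dist (F (s, q)) (F (t, q)) = |(s : ℝ) - t| * dist x y := by
    have key : ∀ (s t : I) q, s ≤ t →
        dist (F (s, q)) (F (t, q)) = |(s : ℝ) - t| * dist x y := by
      intro s t q hst
      -- The Lipschitz bounds on `[0, s]`, `[s, t]`, `[t, 1]` add up to `dist x y`, so none can be
      -- strict.
      refine (hlip s t q).antisymm ?_
      have h2 := hlip 0 s q
      have h3 := hlip t 1 q
      have h4 := dist_triangle4 (F (0, q)) (F (s, q)) (F (t, q)) (F (1, q))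
      rw [hF0, hF1] at h4
      rw [hF0] at h2
      rw [hF1] at h3
      have hs := s.2.1
      have ht := t.2.2
      have hst' : (s : ℝ) ≤ t := hst
      rw [Set.Icc.coe_zero, abs_of_nonpos (by linarith)] at h2
      rw [Set.Icc.coe_one, abs_of_nonpos (by linarith)] at h3
      rw [abs_of_nonpos (by linarith)]
      linarith
    intro s t q
    rcases le_total s t with h | h
    · exact key s t q h
    · rw [dist_comm, abs_sub_comm, key t s q h]
  have hmid : ∀ s : I, s ≠ 0 → s ≠ 1 → 0 < (s : ℝ) ∧ (s : ℝ) < 1 := fun s hs0 hs1 =>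
    ⟨unitInterval.pos_iff_ne_zero.2 hs0, unitInterval.lt_one_iff_ne_one.2 hs1⟩
  refine ⟨F, ⟨hF, fun q => ⟨hF0 q, hF1 q⟩, fun s hs q q' => ?_, fun q =>
    ⟨hF.comp (Continuous.prodMk continuous_id continuous_const), hF0 q, hF1 q,
      fun s t => hdist s t q⟩, ?_⟩, ?_⟩
  · refine dist_le_zero.1 (hclose _ _ 0 le_rfl fun v w => ?_)
    rw [bunchDist_of_mem b hs q q']
    simp
  · intro s t q q' hs ht hne heq
    have h2 := hdist 0 s q
    have h3 := hdist 0 t q'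
    rw [hF0] at h2 h3
    rw [heq, h3] at h2
    have hst : s = t := by
      have h4 := mul_right_cancel₀ hxy.ne' h2
      simp only [Set.Icc.coe_zero, zero_sub, abs_neg, abs_of_nonneg s.2.1,
        abs_of_nonneg t.2.1] at h4
      exact Subtype.ext h4.symm
    subst hst
    obtain ⟨hs0, hs1⟩ := hmid s (fun h => hs (h ▸ h0)) (fun h => hs (h ▸ h1))
    obtain ⟨Ψ, hΨ, hΨd⟩ : ∃ Ψ : BunchSpace R Z → (F (s, q)).Rep, Function.Surjective Ψ ∧
        ∀ v w, dist (Ψ v) (Ψ w) = bunchDist b A (dist x y) (s, q') v w := by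
      rw [heq]
      exact ⟨_, hΦ _, hΦd _⟩
    exact hne (congrArg (Prod.mk s) (eq_of_bunchDist_realized b A hxy hs0 hs1
      ((hA.notMem_iff_infDist_pos ⟨0, h0⟩).1 hs) hperf (hΦ (s, q)) hΨ (hΦd (s, q)) hΨd))
  · rintro ⟨s, q⟩
    by_cases hs0 : s = 0
    · rw [hs0, hF0]
      exact hx
    by_cases hs1 : s = 1
    · rw [hs1, hF1]
      exact hy
    obtain ⟨hs0, hs1⟩ := hmid s hs0 hs1
    have hc : 0 < 2 * dist x y * min (s : ℝ) (1 - s) := by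
      have := lt_min hs0 (sub_pos.2 hs1)
      positivity
    obtain ⟨V, _, _, _, f, hV, hf, hdiam⟩ := hsmall _ hc
    have hiso : Isometry fun v => Φ (s, q) (Sum.inl (b.1, f v)) :=
      Isometry.of_dist_eq fun v w => by
        rw [hΦd, bunchDist_inl, hf.dist_eq]
        rw [hf.dist_eq]
        exact hdiam v w
    exact top_le_iff.1 (hV.symm.le.trans (hD.le_of_isometry hiso))
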